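/- For $n\ge 1$ let $B_n$ be the group of all bijections $\beta$ of $[-n,n]\setminus\{0\}$ with $\beta(-i)=-\beta(i)$ for all $i$ (group operation: composition), and let $$D_n=\{\gamma\in B_n : |\{i\in[n]:\gamma(i)<0\}|\text{ is even}\}$$ be the even-signed permutation group, a Coxeter group of type $D$ with generating set $S_D=\{s_0,s_1,\dots,s_{n-1}\}$, where, writing elements by their values $[\gamma(1),\dots,\gamma(n)]$, $s_0=[-2,-1,3,\dots,n]$ and $s_i=[1,\dots,i-1,i+1,i,i+2,\dots,n]$ for $1\le i\le n-1$ (for $n=1$ the group $D_1$ is trivial and $s_0$ is read as the identity). Let $\ell_D(\gamma)$ be the length of $\gamma\in D_n$ with respect to $S_D$, i.e. the least $k$ such that $\gamma$ is a product of $k$ elements of $S_D$, and let $$\operatorname{Des}_D(\gamma)=\{i\in[0,n-1] : \ell_D(\gamma s_i)<\ell_D(\gamma)\}$$ be its right descent set. Let $\operatorname{Des}(\gamma)=\{i\in[n-1]:\gamma(i)>\gamma(i+1)\}$, and let $\operatorname{dmaj}(\gamma)$ be the sum of the elements (with multiplicity) of the multiset $$\operatorname{DDes}(\gamma)=\operatorname{Des}(\gamma)\uplus\{-\gamma(i)-1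 : i\in[n],\ \gamma(i)<0\}\setminus\{0\}.$$ Then for every $n\ge 1$ and every $M\subseteq[0,n-1]$ the statistics $\operatorname{dmaj}$ and $\ell_D$ are equidistributed over $\{\gamma\in D_n:\operatorname{Des}_D(\gamma^{-1})=M\}$, that is, as polynomials in $q$, $$\sum_{\{\gamma\in D_n\,\mid\,\operatorname{Des}_D(\gamma^{-1})=M\}}q^{\operatorname{dmaj}(\gamma)}=\sum_{\{\gamma\in D_n\,\mid\,\operatorname{Des}_D(\gamma^{-1})=M\}}q^{\ell_D(\gamma)}.$$ -/

import Mathlib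

open scoped Polynomial

namespace TypeD

/-- The set `[-n, n] \ {0}`. -/
abbrev Idx (n : ℕ) : Type := {k : ℤ // k ≠ 0 ∧ -(n : ℤ) ≤ k ∧ k ≤ n}

noncomputable instance (n : ℕ) : Fintype (Idx n) :=
  Fintype.subtype ((Finset.Icc (-(n : ℤ)) n).erase 0) fun k => by
    rw [Finset.mem_erase, Finset.mem_Icc]

/-- The map `k ↦ -k` on `[-n, n] \ {0}`. -/
instance (n : ℕ) : Neg (Idx n) := ⟨fun k => ⟨-(k : ℤ), by have := k.2; omega⟩⟩

@[simp] theorem coe_neg_idx {n : ℕ} (k : Idx n) : ((-k : Idx n) : ℤ) = -(k : ℤ) := rfl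

theorem idx_ne_zero {n : ℕ} (k : Idx n) : (k : ℤ) ≠ 0 := k.2.1

/-- The hyperoctahedral group `B_n`: bijections `β` of `[-n, n] \ {0}` with `β (-i) = -β i`. -/
def B (n : ℕ) : Subgroup (Equiv.Perm (Idx n)) where
  carrier := {β | ∀ i, β (-i) = -β i}
  one_mem' := fun _ => rfl
  mul_mem' := by
    intro a b ha hb i
    simp only [Set.mem_ofPred_eq] at ha hb
    simp [Equiv.Perm.mul_apply, ha, hb]
  inv_mem' := by
    intro a ha i
    simp only [Set.mem_ofPred_eq] at ha
    apply a.injective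
    rw [ha]
    simp

/-- The subset `[n]` of `[-n, n] \ {0}`. -/
noncomputable def posIdx (n : ℕ) : Finset (Idx n) := Finset.univ.filter fun k => 0 < (k : ℤ)

@[simp] theorem mem_posIdx {n : ℕ} (k : Idx n) : k ∈ posIdx n ↔ 0 < (k : ℤ) := by
  simp [posIdx]

/-- `N₁(β) = |{i ∈ [n] : β(i) < 0}|`. -/
noncomputable def N1 {n : ℕ} (β : Equiv.Perm (Idx n)) : ℕ :=
  ((posIdx n).filter fun i => (β i : ℤ) < 0).card

/-- An even function on `[-n, n] \ {0}` has the same sum over `[n]` after composition with a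
signed permutation. -/
theorem sum_pos_comp {n : ℕ} (f : Idx n → ℕ) (hf : ∀ k, f (-k) = f k)
    (β : Equiv.Perm (Idx n)) (hβ : ∀ i, β (-i) = -β i) :
    ∑ k ∈ posIdx n, f (β k) = ∑ k ∈ posIdx n, f k := by
  have key : ∀ g : Idx n → ℕ, (∀ k, g (-k) = g k) →
      ∑ k, g k = 2 * ∑ k ∈ posIdx n, g k := by
    intro g hg
    rw [← Finset.sum_filter_add_sum_filter_not Finset.univ (fun k : Idx n => 0 < (k : ℤ)),
      two_mul, posIdx]
    congr 1
    refine Finset.sum_bij' (fun k _ => -k) (fun k _ => -k) ?_ ?_ ?_ ?_ ?_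
    · intro k hk
      have := idx_ne_zero k
      simp only [Finset.mem_filter, Finset.mem_univ, true_and, coe_neg_idx] at hk ⊢
      omega
    · intro k hk
      simp only [Finset.mem_filter, Finset.mem_univ, true_and, coe_neg_idx] at hk ⊢
      omega
    · intro k _
      exact Subtype.ext (neg_neg _)
    · intro k _
      exact Subtype.ext (neg_neg _)
    · intro k _
      exact (hg k).symm
  have h1 := key (fun k => f (β k)) (fun k => by simp only [hβ, hf])
  have h2 := key f hf
  have h3 : ∑ k, f (β k) = ∑ k, f k := Equiv.sum_comp β f
  omega

/-- The parity of `N₁` is additive on `B_n`. -/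
theorem N1_mul_mod_two {n : ℕ} {α β : Equiv.Perm (Idx n)} (hα : α ∈ B n) (hβ : β ∈ B n) :
    N1 (α * β) % 2 = (N1 α + N1 β) % 2 := by
  have hα' : ∀ i, α (-i) = -α i := hα
  have hβ' : ∀ i, β (-i) = -β i := hβ
  have hN : ∀ γ : Equiv.Perm (Idx n),
      N1 γ = ∑ k ∈ posIdx n, if (γ k : ℤ) < 0 then 1 else 0 := by
    intro γ
    rw [N1, Finset.card_filter]
  let f : Idx n → ℕ := fun k => if ((α k : ℤ) < 0 ↔ (k : ℤ) < 0) then 0 else 1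
  have hf : ∀ k, f (-k) = f k := by
    intro k
    have h1 := idx_ne_zero k
    have h2 := idx_ne_zero (α k)
    simp only [f, hα', coe_neg_idx]
    congr 1
    apply propext
    constructor <;> intro h <;> omega
  have h1 : N1 α = ∑ k ∈ posIdx n, f k := by
    rw [hN]
    refine Finset.sum_congr rfl fun k hk => ?_
    rw [mem_posIdx] at hk
    have : ¬ (k : ℤ) < 0 := by omega
    by_cases h : (α k : ℤ) < 0 <;> simp [f, h, this]
  rw [h1, ← sum_pos_comp f hf β hβ', hN β, hN (α * β), ← Finset.sum_add_distrib,
    Finset.sum_nat_mod,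
    Finset.sum_nat_mod _ _ (fun k => f (β k) + if (β k : ℤ) < 0 then 1 else 0)]
  congr 1
  refine Finset.sum_congr rfl fun k _ => ?_
  simp only [f, Equiv.Perm.mul_apply]
  by_cases h : (α (β k) : ℤ) < 0 <;> by_cases h' : (β k : ℤ) < 0 <;> simp [h, h']

theorem N1_one (n : ℕ) : N1 (1 : Equiv.Perm (Idx n)) = 0 := by
  rw [N1, Finset.card_eq_zero, Finset.filter_eq_empty_iff]
  intro k hk
  rw [mem_posIdx] at hk
  simp only [Equiv.Perm.one_apply]
  omega

/-- The even-signed permutation group `D_n`: the signed permutations in `B_n` having an even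
number of negative entries in their window notation. -/
def D (n : ℕ) : Subgroup (Equiv.Perm (Idx n)) where
  carrier := {γ | γ ∈ B n ∧ Even (N1 γ)}
  one_mem' := ⟨one_mem _, by simp [N1_one]⟩
  mul_mem' := by
    rintro a b ⟨ha, ha'⟩ ⟨hb, hb'⟩
    refine ⟨mul_mem ha hb, ?_⟩
    rw [Nat.even_iff] at *
    have := N1_mul_mod_two ha hb
    omega
  inv_mem' := by
    rintro a ⟨ha, ha'⟩
    refine ⟨inv_mem ha, ?_⟩
    rw [Nat.even_iff] at *
    have := N1_mul_mod_two ha (inv_mem ha)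
    rw [mul_inv_cancel, N1_one] at this
    omega

noncomputable instance (n : ℕ) : Fintype (D n) := Fintype.ofFinite _

/-- The signed transposition exchanging `a` with `b` and `-a` with `-b`. -/
def signedSwap {n : ℕ} (a b : Idx n) : Equiv.Perm (Idx n) :=
  Equiv.swap a b * Equiv.swap (-a) (-b)

/-- The signed permutation `s_i^D` for `0 ≤ i ≤ n - 1`, where `s_0^D = [-2, -1, 3, …, n]` and
`s_i^D = [1, …, i - 1, i + 1, i, i + 2, …, n]` for `i ≥ 1`. In the degenerate case `n = 1`, in
which `D_1` is trivial and `[-2, -1, 3, …, n]` makes no sense, `s_0^D` is the identity. -/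
def gen (n : ℕ) (i : Fin n) : Equiv.Perm (Idx n) :=
  if hi : (i : ℕ) = 0 then
    if hn : 2 ≤ n then
      signedSwap
        ⟨1, by omega⟩
        ⟨-2, by omega⟩
    else 1
  else
    signedSwap
      ⟨((i : ℕ) : ℤ), by omega⟩
      ⟨((i : ℕ) : ℤ) + 1, by omega⟩

/-- The length `ℓ_D` with respect to `S_D = {s_0^D, …, s_{n-1}^D}`: the least `k` such that `γ` is
a product of `k` elements of `S_D`. -/
noncomputable def lengthD {n : ℕ} (γ : Equiv.Perm (Idx n)) : ℕ :=
  sInf {k | ∃ w : List (Fin n), w.length = k ∧ (w.map (gen n)).prod = γ}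

/-- The right descent set `Des_D(γ) = {i ∈ [0, n - 1] : ℓ_D(γ s_i) < ℓ_D(γ)}`. -/
noncomputable def DesD {n : ℕ} (γ : Equiv.Perm (Idx n)) : Finset ℕ :=
  (Finset.univ.filter fun i : Fin n => lengthD (γ * gen n i) < lengthD γ).map Fin.valEmbedding

/-- The entry `γ(i)` for `i ∈ [-n, n] \ {0}` (and `0` for other `i`). -/
def entry {n : ℕ} (γ : Equiv.Perm (Idx n)) (i : ℤ) : ℤ :=
  if h : i ≠ 0 ∧ -(n : ℤ) ≤ i ∧ i ≤ n then (γ ⟨i, h⟩ : ℤ) else 0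

/-- The usual descent set `Des(γ) = {i ∈ [n - 1] : γ(i) > γ(i + 1)}` of the window of `γ`. -/
def Des {n : ℕ} (γ : Equiv.Perm (Idx n)) : Finset ℕ :=
  (Finset.Icc 1 (n - 1)).filter fun i => entry γ i > entry γ (i + 1)

/-- The multiset `DDes(γ) = Des(γ) ⊎ {-γ(i) - 1 : i ∈ [n], γ(i) < 0} \ {0}`. -/
def DDes {n : ℕ} (γ : Equiv.Perm (Idx n)) : Multiset ℕ :=
  (Des γ).val +
    (((Finset.Icc 1 n).filter fun i : ℕ => entry γ i < 0).val.map
      fun i : ℕ => (-entry γ i - 1).toNat).filter (· ≠ 0)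

/-- `dmaj(γ)` is the sum of the elements of `DDes(γ)`, counted with multiplicity. -/
def dmaj {n : ℕ} (γ : Equiv.Perm (Idx n)) : ℕ := (DDes γ).sum

end TypeD

/-! Read the window `γ(1), …, γ(n)` as a word with distinct letters. Then `dmaj` is its major index
plus the sum of `-x - 1` over the negative letters `x` (`dmaj_eq`), and `ℓ_D` is its number of
inversions plus the same sum (`lengthD_eq`). The common term depends only on the set of letters, so
Foata's second fundamental transformation, which rearranges a word and turns its major index into
its inversion number (`invList_foata`), carries `dmaj` to `ℓ_D`. Rearranging a window keeps the
number of negative letters even, so this acts on `D_n`; it is injective, hence bijective by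
finiteness.

It remains to see that the descent set of the inverse is preserved. Whether `i` is a descent of
`γ⁻¹` depends on comparing `γ⁻¹(p)` with `γ⁻¹(q)`, where `(p, q)` is `(i, i + 1)`, or `(-1, 2)` for
`i = 0`. The signs of these values only record which of `±p`, `±q` are letters of the window. If the
signs agree, the comparison is the relative position of the letters `p, q` (or `-q, -p`). No letter
of the window lies strictly between these two in value, and Foata's transformation never changes the
relative position of such a pair (`pair_sublist_foata`).

The formula for `ℓ_D` comes from counting the positive roots made negative by `γ`. -/

namespace TypeD

/-! ### Foata's second fundamental transformation on words. -/

section Foata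

variable {α : Type*}

/-- Words are read from right to left in this section. Cut `b :: l` before each letter satisfying
`p`, and move the first letter of each block to its end. -/
def carry (p : α → Bool) : α → List α → List α
  | b, [] => [b]
  | b, a :: l => if p a then b :: carry p a l else a :: carry p b l

theorem carry_perm (p : α → Bool) (b : α) (l : List α) : (carry p b l).Perm (b :: l) := by
  induction l generalizing b with
  | nil => simp [carry]
  | cons a l ih =>
    rw [carry]
    split_ifs
    · exact (ih a).cons b
    · exact ((ih b).cons a).trans (List.Perm.swap b a l)

theorem filter_carry (p : α → Bool) {b : α} (hb : p b) (l : List α) :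
    (carry p b l).filter p = (b :: l).filter p := by
  induction l generalizing b with
  | nil => simp [carry]
  | cons a l ih =>
    rw [carry]
    split_ifs with ha
    · simp [ih ha, hb, ha]
    · simp [ih hb, hb, ha]

theorem filter_not_carry (p : α → Bool) {b : α} (hb : p b) (l : List α) :
    (carry p b l).filter (fun z => !p z) = (b :: l).filter (fun z => !p z) := by
  induction l generalizing b with
  | nil => simp [carry]
  | cons a l ih =>
    rw [carry]
    split_ifs with ha
    · simp [ih ha, hb, ha]
    · simp [ih hb, hb, ha]

/-- The letter being carried always satisfies `p` and is the last to be put down. This end letter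
later reveals which predicate was used. -/
theorem getLast?_carry (p : α → Bool) {b : α} (hb : p b) (l : List α) :
    ∃ z, (carry p b l).getLast? = some z ∧ p z := by
  induction l generalizing b with
  | nil => exact ⟨b, rfl, hb⟩
  | cons a l ih =>
    rw [carry]
    split_ifs with ha
    · obtain ⟨z, h1, h2⟩ := ih ha
      exact ⟨z, by simp [List.getLast?_cons, h1], h2⟩
    · obtain ⟨z, h1, h2⟩ := ih hb
      exact ⟨z, by simp [List.getLast?_cons, h1], h2⟩

/-- The head of the output satisfies `p` exactly when the second letter of the input did, so each
branch of the recursion can be undone. -/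
theorem carry_injective (p : α → Bool) {b b' : α} (hb : p b) (hb' : p b') {l l' : List α}
    (h : carry p b l = carry p b' l') : b = b' ∧ l = l' := by
  induction l generalizing b b' l' with
  | nil =>
    have hlen := (carry_perm p b' l').length_eq
    rw [← h] at hlen
    cases l' with
    | nil => simpa [carry] using h
    | cons a' l' => simp [carry] at hlen
  | cons a l ih =>
    cases l' with
    | nil =>
      have hlen := (carry_perm p b (a :: l)).length_eq
      rw [h] at hlen
      simp [carry] at hlen
    | cons a' l' =>
      rw [carry, carry] at h
      split_ifs at h with h1 h2 h2
      · obtain ⟨h3, h4⟩ := List.cons_eq_cons.1 h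
        obtain ⟨h5, h6⟩ := ih h1 h2 h4
        exact ⟨h3, by rw [h5, h6]⟩
      · obtain ⟨h3, h4⟩ := List.cons_eq_cons.1 h
        exact absurd (h3 ▸ hb) h2
      · obtain ⟨h3, h4⟩ := List.cons_eq_cons.1 h
        exact absurd (h3 ▸ hb') h1
      · obtain ⟨h3, h4⟩ := List.cons_eq_cons.1 h
        obtain ⟨h5, h6⟩ := ih hb hb' h4
        exact ⟨h5, by rw [h3, h6]⟩

variable [LinearOrder α]

/-- The number of inversions of a word read from right to left. -/
def invList : List α → ℕ
  | [] => 0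
  | x :: w => w.countP (fun z => x < z) + invList w

/-- The major index of a word read from right to left. -/
def majList : List α → ℕ
  | [] => 0
  | [_] => 0
  | x :: y :: w => (if x < y then w.length + 1 else 0) + majList (y :: w)

/-- Every letter failing `p` is jumped over by exactly one smaller letter, the head of its block;
each jump destroys one inversion. -/
theorem invList_carry_of_lt (p : α → Bool) (hp : ∀ u v, p u → ¬ p v → u < v) {b : α} (hb : p b)
    (l : List α) : invList (carry p b l) + l.countP (fun z => !p z) = invList (b :: l) := by
  induction l generalizing b with
  | nil => simp [carry]
  | cons a l ih =>
    rw [carry]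
    split_ifs with ha
    · have := ih ha
      rw [invList, (carry_perm p a l).countP_eq, invList, List.countP_cons (p := fun z => !p z)]
      simp only [ha]
      simp
      omega
    · have := ih hb
      have hlt := hp b a hb ha
      rw [invList, (carry_perm p b l).countP_eq, invList, invList]
      rw [invList] at this
      simp [ha, hlt, hlt.not_gt]
      omega

theorem invList_carry_of_gt (p : α → Bool) (hp : ∀ u v, p u → ¬ p v → v < u) {b : α} (hb : p b)
    (l : List α) : invList (carry p b l) = invList (b :: l) + l.countP (fun z => !p z) := by
  induction l generalizing b with
  | nil => simp [carry]
  | cons a l ih =>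
    rw [carry]
    split_ifs with ha
    · have := ih ha
      rw [invList, (carry_perm p a l).countP_eq, invList, List.countP_cons (p := fun z => !p z)]
      simp only [ha]
      simp
      omega
    · have := ih hb
      have hlt := hp b a hb ha
      rw [invList, (carry_perm p b l).countP_eq, invList, invList]
      rw [invList] at this
      simp [ha, hlt, hlt.not_gt]
      omega

/-- The image of the word `x :: w` under Foata's transformation, without its first letter. -/
def foataTail : α → List α → List α
  | _, [] => []
  | x, y :: w => carry (fun z => decide (z < x) == decide (y < x)) y (foataTail y w)

/-- Foata's second fundamental transformation, for words read from right to left. -/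
def foata : List α → List α
  | [] => []
  | x :: w => x :: foataTail x w

theorem foataTail_perm (x : α) (w : List α) : (foataTail x w).Perm w := by
  induction w generalizing x with
  | nil => simp [foataTail]
  | cons y w ih => exact (carry_perm _ _ _).trans ((ih y).cons y)

theorem foata_perm (w : List α) : (foata w).Perm w := by
  cases w with
  | nil => simp [foata]
  | cons x w => exact (foataTail_perm x w).cons x

/-- The end letter of the output lies on the same side of `x` as `y`. Hence the output determines
the predicate, and `carry_injective` applies. -/
theorem foataTail_injective (x : α) : Function.Injective (foataTail x) := by
  intro w w' h
  induction w generalizing x w' with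
  | nil => simpa [foataTail] using (foataTail_perm x []).symm.trans (h ▸ foataTail_perm x w')
  | cons y w ih =>
    cases w' with
    | nil => simpa [foataTail] using
      ((foataTail_perm x (y :: w)).symm.trans (h ▸ foataTail_perm x [])).eq_nil
    | cons y' w' =>
      rw [foataTail, foataTail] at h
      have key : (y < x ↔ y' < x) := by
        obtain ⟨z, hz, h1⟩ := getLast?_carry (fun z => decide (z < x) == decide (y < x))
          (b := y) (by simp) (foataTail y w)
        obtain ⟨z', hz', h2⟩ := getLast?_carry (fun z => decide (z < x) == decide (y' < x))
          (b := y') (by simp) (foataTail y' w')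
        rw [h, hz', Option.some_inj] at hz
        subst hz
        simp only [beq_iff_eq, decide_eq_decide] at h1 h2
        rw [← h1, h2]
      simp only [← decide_eq_decide] at key
      rw [key] at h
      obtain ⟨h1, h2⟩ := carry_injective _ (by simp [key]) (by simp) h
      subst h1
      rw [ih y h2]

theorem foata_injective : Function.Injective (foata (α := α)) := by
  intro w w' h
  cases w with
  | nil => simpa [foata] using (foata_perm []).symm.trans (h ▸ foata_perm w')
  | cons x w =>
    cases w' with
    | nil => simp [foata] at h
    | cons x' w' =>
      obtain ⟨rfl, h2⟩ := List.cons_eq_cons.1 h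
      rw [foataTail_injective x h2]

/-- Compare the effects of appending `x` after `y`. If `y < x`, there is no new descent, and the
inversions created by `x` are cancelled by the jumps of letters below `x` over those above. If `x <
y`, the jumps add one inversion for each letter below `x` while `x` creates one for each letter
above, in total the position of the new descent. -/
theorem invList_foata {w : List α} (hw : w.Nodup) : invList (foata w) = majList w := by
  induction w with
  | nil => rfl
  | cons x w ih =>
    cases w with
    | nil => rfl
    | cons y w =>
      have ih := ih (List.nodup_cons.1 hw).2
      have hx : x ∉ y :: w := (List.nodup_cons.1 hw).1
      rw [foata] at ih
      rw [foata, invList, majList, (foataTail_perm x (y :: w)).countP_eq, foataTail]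
      have hne : ∀ z ∈ w, z ≠ x := fun z hz h => hx (by simp [← h, hz])
      have hyx : y ≠ x := fun h => hx (by simp [h])
      rcases lt_or_gt_of_ne hyx with hlt | hlt
      · have := invList_carry_of_lt (fun z => decide (z < x) == decide (y < x))
          (by intro u v; simp only [hlt, decide_true, beq_true, decide_eq_true_eq, not_lt]
              exact lt_of_lt_of_le) (b := y) (by simp) (foataTail y w)
        rw [(foataTail_perm y w).countP_eq] at this
        have h2 : w.countP (fun z => !(decide (z < x) == decide (y < x))) = w.countP (fun z => x < z) := by
          apply List.countP_congr
          intro z hz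
          have := hne z hz
          simp [hlt, le_iff_lt_or_eq, this.symm]
        rw [List.countP_cons]
        simp only [hlt.not_gt]
        simp
        omega
      · have := invList_carry_of_gt (fun z => decide (z < x) == decide (y < x))
          (by intro u v; simp [hlt.not_gt]
              exact fun h1 h2 => lt_of_lt_of_le h2 h1) (b := y) (by simp) (foataTail y w)
        rw [(foataTail_perm y w).countP_eq] at this
        have h2 : w.countP (fun z => !(decide (z < x) == decide (y < x))) = w.countP (fun z => ¬ x < z) := by
          apply List.countP_congr
          intro z hz
          have := hne z hz
          simp [hlt.not_gt, lt_iff_le_and_ne, this]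
          exact fun h => h.ge
        have h3 := List.length_eq_countP_add_countP (fun z => decide (x < z)) (l := w)
        rw [List.countP_cons]
        simp only [hlt]
        simp at h2 h3 ⊢
        omega

/-- A letter `x` other than `a`, `b` has both on one side, so both satisfy the carrying predicate or
both fail it, and `carry` preserves the order within each class. If `x` is `a` or `b`, at most one
of the two is left and there is no order to preserve. -/
theorem filter_eq_or_foata {w : List α} (hw : w.Nodup) {a b : α}
    (hab : ∀ z ∈ w, z ≠ a → z ≠ b → (a < z ↔ b < z)) :
    (foata w).filter (fun z => z = a ∨ z = b) = w.filter (fun z => z = a ∨ z = b) := by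
  induction w with
  | nil => rfl
  | cons x w ih =>
    cases w with
    | nil => rfl
    | cons y w =>
      have hw' := List.nodup_cons.1 hw
      have ih := ih hw'.2 fun z hz => hab z (List.mem_cons_of_mem _ hz)
      have key : (foataTail x (y :: w)).filter (fun z => z = a ∨ z = b) =
          (y :: w).filter (fun z => z = a ∨ z = b) := by
        have hperm := foataTail_perm x (y :: w)
        by_cases hxa : x = a
        · have h1 : ∀ l : List α, l.Perm (y :: w) → l.filter (fun z => z = a ∨ z = b) =
              l.filter (fun z => z = b) := by
            intro l hl
            apply List.filter_congr
            intro z hz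
            have : z ≠ a := by
              rintro rfl
              exact hw'.1 (hxa ▸ hl.subset hz)
            simp [this]
          rw [h1 _ hperm, h1 _ (List.Perm.refl _), List.filter_eq, List.filter_eq,
            hperm.count_eq]
        by_cases hxb : x = b
        · have h1 : ∀ l : List α, l.Perm (y :: w) → l.filter (fun z => z = a ∨ z = b) =
              l.filter (fun z => z = a) := by
            intro l hl
            apply List.filter_congr
            intro z hz
            have : z ≠ b := by
              rintro rfl
              exact hw'.1 (hxb ▸ hl.subset hz)
            simp [this]
          rw [h1 _ hperm, h1 _ (List.Perm.refl _), List.filter_eq, List.filter_eq,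
            hperm.count_eq]
        have hx := hab x (by simp) hxa hxb
        rw [← ih, foata, foataTail]
        by_cases hp : (decide (a < x) = decide (y < x))
        · have h1 : ∀ l : List α, l.filter (fun z => decide (z = a ∨ z = b)) =
              (l.filter (fun z => decide (z < x) == decide (y < x))).filter
                (fun z => decide (z = a ∨ z = b)) := by
            intro l
            rw [List.filter_filter]
            apply List.filter_congr
            intro z _
            by_cases hz : z = a
            · subst hz; simp [hp]
            by_cases hz' : z = b
            · subst hz'; simp [← hx, hp]
            simp [hz, hz']
          rw [h1, filter_carry _ (by simp), ← h1]
        · have h1 : ∀ l : List α, l.filter (fun z => decide (z = a ∨ z = b)) =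
              (l.filter (fun z => !(decide (z < x) == decide (y < x)))).filter
                (fun z => decide (z = a ∨ z = b)) := by
            intro l
            rw [List.filter_filter]
            apply List.filter_congr
            intro z _
            by_cases hz : z = a
            · subst hz; simp [hp]
            by_cases hz' : z = b
            · subst hz'; simp [← hx, hp]
            simp [hz, hz']
          rw [h1, filter_not_carry _ (by simp), ← h1]
      rw [foata, List.filter_cons, List.filter_cons, key]

theorem pair_sublist_foata {w : List α} (hw : w.Nodup) {a b : α}
    (hab : ∀ z ∈ w, z ≠ a → z ≠ b → (a < z ↔ b < z)) :
    [a, b].Sublist (foata w) ↔ [a, b].Sublist w := by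
  have key : ∀ l : List α, [a, b].Sublist l ↔
      [a, b].Sublist (l.filter (fun z => z = a ∨ z = b)) := by
    intro l
    constructor
    · intro h
      simpa using h.filter (fun z => decide (z = a ∨ z = b))
    · intro h
      exact h.trans List.filter_sublist
  rw [key, filter_eq_or_foata hw hab, ← key]

end Foata

/-! ### Windows as words, and their statistics in terms of positions. -/

/-- The window `f 1, …, f n`, as a word read from right to left. -/
def word (f : ℤ → ℤ) : ℕ → List ℤ
  | 0 => []
  | n + 1 => f (n + 1) :: word f n

theorem mem_word {f : ℤ → ℤ} {n : ℕ} {x : ℤ} :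
    x ∈ word f n ↔ ∃ i, 1 ≤ i ∧ i ≤ (n : ℤ) ∧ f i = x := by
  induction n with
  | zero =>
    simp only [word, List.not_mem_nil, false_iff]
    rintro ⟨i, h1, h2, -⟩
    push_cast at h2
    omega
  | succ n ih =>
    rw [word, List.mem_cons, ih]
    constructor
    · rintro (rfl | ⟨i, h1, h2, h3⟩)
      · exact ⟨n + 1, by omega, by push_cast; omega, rfl⟩
      · exact ⟨i, h1, by push_cast; omega, h3⟩
    · rintro ⟨i, h1, h2, rfl⟩
      push_cast at h2
      by_cases h : i = n + 1
      · left; rw [h]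
      · right; exact ⟨i, h1, by omega, rfl⟩

theorem pair_sublist_word {f : ℤ → ℤ} {n : ℕ} {x y : ℤ} :
    [x, y].Sublist (word f n) ↔
      ∃ i j, 1 ≤ j ∧ j < i ∧ i ≤ (n : ℤ) ∧ f i = x ∧ f j = y := by
  induction n with
  | zero =>
    simp only [word, List.sublist_nil, reduceCtorEq, false_iff]
    rintro ⟨i, j, h1, h2, h3, -⟩
    push_cast at h3
    omega
  | succ n ih =>
    rw [word, List.cons_sublist_cons', ih, List.singleton_sublist, mem_word]
    constructor
    · rintro (⟨i, j, h1, h2, h3, h4, h5⟩ | ⟨rfl, j, h1, h2, h3⟩)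
      · exact ⟨i, j, h1, h2, by push_cast; omega, h4, h5⟩
      · exact ⟨n + 1, j, h1, by omega, by push_cast; omega, rfl, h3⟩
    · rintro ⟨i, j, h1, h2, h3, rfl, rfl⟩
      push_cast at h3
      by_cases h : i = n + 1
      · right; exact ⟨by rw [h], j, h1, by omega, rfl⟩
      · left; exact ⟨i, j, h1, h2, by omega, rfl, rfl⟩

theorem eq_of_word_eq {f g : ℤ → ℤ} {n : ℕ} (h : word f n = word g n) {i : ℤ} (h1 : 1 ≤ i)
    (h2 : i ≤ n) : f i = g i := by
  induction n with
  | zero => push_cast at h2; omega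
  | succ n ih =>
    rw [word, word, List.cons_eq_cons] at h
    push_cast at h2
    by_cases hi : i = n + 1
    · rw [hi, h.1]
    · exact ih h.2 (by omega)

theorem word_congr {f g : ℤ → ℤ} {n : ℕ} (h : ∀ i, 1 ≤ i → i ≤ (n : ℤ) → f i = g i) :
    word f n = word g n := by
  induction n with
  | zero => rfl
  | succ n ih =>
    rw [word, word, h _ (by omega) (by push_cast; omega),
      ih fun i h1 h2 => h i h1 (by push_cast; omega)]

theorem exists_word_eq {n : ℕ} {l : List ℤ} (hl : l.length = n) : ∃ f, word f n = l := by
  induction n generalizing l with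
  | zero => exact ⟨fun _ => 0, by simp_all [word]⟩
  | succ n ih =>
    cases l with
    | nil => simp at hl
    | cons x l =>
      obtain ⟨f, hf⟩ := ih (l := l) (by simpa using hl)
      refine ⟨fun i => if i = n + 1 then x else f i, ?_⟩
      rw [word, if_pos rfl, ← hf]
      congr 1
      apply word_congr
      intro i _ _
      rw [if_neg (by omega)]

theorem length_word (f : ℤ → ℤ) (n : ℕ) : (word f n).length = n := by
  induction n with
  | zero => rfl
  | succ n ih => rw [word, List.length_cons, ih]

theorem nodup_word {f : ℤ → ℤ} {n : ℕ} :
    (word f n).Nodup ↔ ∀ i j, 1 ≤ j → j < i → i ≤ (n : ℤ) → f i ≠ f j := by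
  rw [List.nodup_iff_sublist]
  simp only [pair_sublist_word]
  constructor
  · intro h i j h1 h2 h3 h4
    exact h (f j) ⟨i, j, h1, h2, h3, h4, rfl⟩
  · rintro h a ⟨i, j, h1, h2, h3, h4, h5⟩
    exact h i j h1 h2 h3 (h4.trans h5.symm)

theorem Icc_one_succ (n : ℕ) :
    Finset.Icc 1 ((n + 1 : ℕ) : ℤ) = insert ((n : ℤ) + 1) (Finset.Icc 1 (n : ℤ)) := by
  ext x
  simp only [Finset.mem_Icc, Finset.mem_insert]
  push_cast
  omega

theorem sum_map_word (g : ℤ → ℕ) (f : ℤ → ℤ) (n : ℕ) :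
    ((word f n).map g).sum = ∑ i ∈ Finset.Icc 1 (n : ℤ), g (f i) := by
  induction n with
  | zero => simp [word]
  | succ n ih =>
    rw [word, List.map_cons, List.sum_cons, ih, Icc_one_succ, Finset.sum_insert (by simp)]

theorem countP_word (p : ℤ → Prop) [DecidablePred p] (f : ℤ → ℤ) (n : ℕ) :
    (word f n).countP p = ((Finset.Icc 1 (n : ℤ)).filter fun i => p (f i)).card := by
  induction n with
  | zero => simp [word]
  | succ n ih =>
    rw [word, List.countP_cons, ih, Icc_one_succ, Finset.filter_insert]
    split_ifs with h1 h2 h2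
    · rw [Finset.card_insert_of_notMem (by simp)]
    · simp_all
    · simp_all
    · rfl

theorem invList_word_eq_sum (f : ℤ → ℤ) (n : ℕ) :
    invList (word f n) =
      ∑ b ∈ Finset.Icc 1 (n : ℤ), ((Finset.Ico 1 b).filter fun a => f b < f a).card := by
  induction n with
  | zero => simp [word, invList]
  | succ n ih =>
    rw [word, invList, ih, Icc_one_succ, Finset.sum_insert (by simp), countP_word]
    congr 3

theorem invList_word (f : ℤ → ℤ) (n : ℕ) :
    invList (word f n) = ((Finset.Icc 1 (n : ℤ) ×ˢ Finset.Icc 1 (n : ℤ)).filter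
      fun x => x.1 < x.2 ∧ f x.2 < f x.1).card := by
  rw [invList_word_eq_sum, Finset.card_filter, Finset.sum_product_right]
  refine Finset.sum_congr rfl fun b hb => ?_
  rw [← Finset.card_filter]
  congr 1
  ext x
  simp only [Finset.mem_filter, Finset.mem_Icc, Finset.mem_Ico] at hb ⊢
  constructor <;> intro h <;> refine ⟨?_, ?_⟩ <;> try omega

theorem majList_word (f : ℤ → ℤ) (n : ℕ) :
    majList (word f n) = ∑ i ∈ (Finset.Icc 1 (n - 1)).filter fun i : ℕ => f (i + 1) < f i, i := by
  induction n with
  | zero => simp [word, majList]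
  | succ n ih =>
    cases n with
    | zero => simp [word, majList]
    | succ n =>
      rw [word, word, majList, ← word, ih, length_word]
      have : Finset.Icc 1 (n + 1 + 1 - 1) = insert (n + 1) (Finset.Icc 1 (n + 1 - 1)) := by
        ext x
        simp only [Finset.mem_Icc, Finset.mem_insert]
        omega
      rw [this, Finset.filter_insert]
      push_cast
      split_ifs with h
      · rw [Finset.sum_insert (by simp)]
      · simp

/-! ### Signed permutations and the roots they invert. -/

/-- `f` restricts to a signed permutation of `[-n, n] \ {0}`. -/
structure IsSigned (n : ℕ) (f : ℤ → ℤ) : Prop where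
  odd : ∀ k, f (-k) = -f k
  ne_zero : ∀ k, 1 ≤ k → k ≤ (n : ℤ) → f k ≠ 0
  abs_le : ∀ k, 1 ≤ k → k ≤ (n : ℤ) → |f k| ≤ n
  abs_inj : ∀ a b, 1 ≤ a → a ≤ (n : ℤ) → 1 ≤ b → b ≤ (n : ℤ) → |f a| = |f b| → a = b

theorem IsSigned.image_abs {n : ℕ} {f : ℤ → ℤ} (hf : IsSigned n f) :
    (Finset.Icc 1 (n : ℤ)).image (fun k => |f k|) = Finset.Icc 1 (n : ℤ) := by
  apply Finset.eq_of_subset_of_card_le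
  · intro x hx
    obtain ⟨k, hk, rfl⟩ := Finset.mem_image.1 hx
    rw [Finset.mem_Icc] at hk ⊢
    have h1 := abs_pos.2 (hf.ne_zero k hk.1 hk.2)
    exact ⟨by omega, hf.abs_le k hk.1 hk.2⟩
  · rw [Finset.card_image_of_injOn]
    intro a ha b hb hab
    simp only [Finset.coe_Icc, Set.mem_Icc] at ha hb
    exact hf.abs_inj a b ha.1 ha.2 hb.1 hb.2 hab

theorem IsSigned.card_abs_lt {n : ℕ} {f : ℤ → ℤ} (hf : IsSigned n f) {m : ℤ} (hm : m ≤ n) :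
    ((Finset.Icc 1 (n : ℤ)).filter fun k => |f k| < m).card = (m - 1).toNat := by
  have h1 : (((Finset.Icc 1 (n : ℤ)).image (fun k => |f k|)).filter (· < m)).card =
      ((Finset.Icc 1 (n : ℤ)).filter fun k => |f k| < m).card := by
    rw [Finset.filter_image, Finset.card_image_of_injOn]
    intro a ha b hb hab
    simp only [Finset.coe_filter, Finset.mem_Icc] at ha hb
    exact hf.abs_inj a b ha.1.1 ha.1.2 hb.1.1 hb.1.2 hab
  rw [← h1, hf.image_abs, ← Int.card_Ico]
  congr 1
  ext x
  simp only [Finset.mem_filter, Finset.mem_Icc, Finset.mem_Ico]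
  omega

/-- The sum of `-x - 1` over the negative letters `x` of a word. -/
def negSum (w : List ℤ) : ℕ := (w.map fun x => (-x - 1).toNat).sum

/-- The absolute values of the letters are `1, …, n`, so a negative letter `x` contributes the
number of letters smaller in absolute value. A pair has negative sum exactly when its member of
larger absolute value is negative, so both sides count unordered pairs. -/
theorem IsSigned.negSum_word {n : ℕ} {f : ℤ → ℤ} (hf : IsSigned n f) :
    negSum (word f n) = ((Finset.Icc 1 (n : ℤ) ×ˢ Finset.Icc 1 (n : ℤ)).filter
      fun x => x.1 < x.2 ∧ f x.2 < -f x.1).card := by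
  have h1 : negSum (word f n) = ((Finset.Icc 1 (n : ℤ) ×ˢ Finset.Icc 1 (n : ℤ)).filter
      fun x => f x.1 < 0 ∧ |f x.2| < |f x.1|).card := by
    rw [negSum, sum_map_word, Finset.card_filter, Finset.sum_product]
    refine Finset.sum_congr rfl fun a ha => ?_
    rw [← Finset.card_filter]
    rw [Finset.mem_Icc] at ha
    by_cases h : f a < 0
    · have h2 := hf.card_abs_lt (hf.abs_le a ha.1 ha.2)
      simp only [h, true_and, h2]
      rw [abs_of_neg h]
    · simp only [h, false_and, Finset.filter_false, Finset.card_empty]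
      omega
  rw [h1]
  refine Finset.card_nbij' (fun x => if x.1 < x.2 then x else x.swap)
    (fun x => if |f x.2| < |f x.1| then x else x.swap) ?_ ?_ ?_ ?_
  · rintro ⟨a, b⟩ hx
    simp only [Finset.coe_filter, Finset.mem_product, Finset.mem_Icc, Set.mem_ofPred_eq] at hx ⊢
    have hab : a ≠ b := by rintro rfl; omega
    split_ifs with h <;> simp only [Prod.fst_swap, Prod.snd_swap]
    · refine ⟨hx.1, h, ?_⟩
      have := neg_abs_le (f b); have := le_abs_self (f b)
      rw [abs_of_neg hx.2.1] at hx
      omega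
    · refine ⟨⟨hx.1.2, hx.1.1⟩, by omega, ?_⟩
      have := neg_abs_le (f b); have := le_abs_self (f b)
      rw [abs_of_neg hx.2.1] at hx
      omega
  · rintro ⟨a, b⟩ hx
    simp only [Finset.coe_filter, Finset.mem_product, Finset.mem_Icc, Set.mem_ofPred_eq] at hx ⊢
    split_ifs with h <;> simp only [Prod.fst_swap, Prod.snd_swap]
    · refine ⟨hx.1, ?_, h⟩
      rcases abs_cases (f a) with h2 | h2 <;> rcases abs_cases (f b) with h3 | h3 <;> omega
    · have hne : |f a| ≠ |f b| := fun h' => by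
        have := hf.abs_inj a b hx.1.1.1 hx.1.1.2 hx.1.2.1 hx.1.2.2 h'
        omega
      have h' : |f a| < |f b| := by omega
      refine ⟨⟨hx.1.2, hx.1.1⟩, ?_, h'⟩
      rcases abs_cases (f a) with h2 | h2 <;> rcases abs_cases (f b) with h3 | h3 <;> omega
  · rintro ⟨a, b⟩ hx
    simp only [Finset.coe_filter, Finset.mem_product, Finset.mem_Icc, Set.mem_ofPred_eq] at hx
    by_cases h : a < b
    · simp [h, hx.2.2]
    · simp [h, hx.2.2.not_gt]
  · rintro ⟨a, b⟩ hx
    simp only [Finset.coe_filter, Finset.mem_product, Finset.mem_Icc, Set.mem_ofPred_eq] at hx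
    by_cases h : |f b| < |f a|
    · simp [h, hx.2.1]
    · simp [h, hx.2.1.not_gt]

/-- The pairs `a < b` with `|a| < b ≤ n` and `f a > f b`; they index the positive roots made
negative by `f`. -/
noncomputable def rootInv (n : ℕ) (f : ℤ → ℤ) : Finset (ℤ × ℤ) :=
  (Finset.Icc (-(n : ℤ)) n ×ˢ Finset.Icc 1 (n : ℤ)).filter
    fun x => x.1 ≠ 0 ∧ -x.2 < x.1 ∧ x.1 < x.2 ∧ f x.2 < f x.1

theorem mem_rootInv {n : ℕ} {f : ℤ → ℤ} {a b : ℤ} :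
    (a, b) ∈ rootInv n f ↔ b ≤ n ∧ a ≠ 0 ∧ -b < a ∧ a < b ∧ f b < f a := by
  simp only [rootInv, Finset.mem_filter, Finset.mem_product, Finset.mem_Icc]
  constructor <;> intro h
  · exact ⟨h.1.2.2, h.2⟩
  · exact ⟨by omega, h.2⟩

/-- Pairs with `a > 0` are the ordinary inversions; pairs with `a < 0` become, after `a ↦ -a`, the
pairs with negative sum. -/
theorem IsSigned.card_rootInv {n : ℕ} {f : ℤ → ℤ} (hf : IsSigned n f) :
    (rootInv n f).card = invList (word f n) + negSum (word f n) := by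
  rw [invList_word, hf.negSum_word,
    ← Finset.card_filter_add_card_filter_not (s := rootInv n f) (fun x => 0 < x.1)]
  congr 1
  · congr 1
    ext ⟨a, b⟩
    simp only [Finset.mem_filter, mem_rootInv, Finset.mem_product, Finset.mem_Icc]
    omega
  · refine Finset.card_nbij' (fun x => (-x.1, x.2)) (fun x => (-x.1, x.2)) ?_ ?_ ?_ ?_
    · rintro ⟨a, b⟩ hx
      simp only [Finset.coe_filter, mem_rootInv, Set.mem_ofPred_eq, Finset.mem_product,
        Finset.mem_Icc, hf.odd] at hx ⊢
      omega
    · rintro ⟨a, b⟩ hx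
      simp only [Finset.coe_filter, mem_rootInv, Set.mem_ofPred_eq, Finset.mem_product,
        Finset.mem_Icc, hf.odd] at hx ⊢
      omega
    · rintro ⟨a, b⟩ _
      simp
    · rintro ⟨a, b⟩ _
      simp

/-! ### Effect of a simple reflection on the inverted roots. -/

/-- `(p, q)` is a simple root: either `q = p + 1` with `p` positive, or `(p, q) = (-1, 2)`. -/
def IsSimple (n : ℕ) (p q : ℤ) : Prop :=
  q ≤ n ∧ 2 ≤ q ∧ (p = q - 1 ∨ p = -1 ∧ q = 2)

/-- The action on integers of the signed transposition of `p` and `q`. -/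
def swapZ (p q k : ℤ) : ℤ :=
  if k = p then q else if k = q then p else if k = -p then -q else if k = -q then -p else k

theorem swapZ_swapZ {n : ℕ} {p q : ℤ} (h : IsSimple n p q) (k : ℤ) :
    swapZ p q (swapZ p q k) = k := by
  obtain ⟨h1, h2, h3⟩ := h
  grind [swapZ]

theorem swapZ_neg {n : ℕ} {p q : ℤ} (h : IsSimple n p q) (k : ℤ) :
    swapZ p q (-k) = -swapZ p q k := by
  obtain ⟨h1, h2, h3⟩ := h
  grind [swapZ]

/-- A simple reflection permutes the positive roots other than its own, and its own root becomes
inverted. -/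
theorem card_rootInv_swap {n : ℕ} {p q : ℤ} (h : IsSimple n p q) {f : ℤ → ℤ}
    (hf : ∀ k, f (-k) = -f k) (hpq : f p < f q) :
    (rootInv n fun k => f (swapZ p q k)).card = (rootInv n f).card + 1 := by
  have hmem : (p, q) ∈ rootInv n fun k => f (swapZ p q k) := by
    rw [mem_rootInv]
    obtain ⟨h1, h2, h3⟩ := h
    have e1 : swapZ p q p = q := by simp [swapZ]
    have e2 : swapZ p q q = p := by grind [swapZ]
    rw [e1, e2]
    omega
  rw [← Finset.card_erase_add_one hmem]
  congr 1
  have e1 : swapZ p q (-p) = -q := by rw [swapZ_neg h]; simp [swapZ]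
  have e2 : swapZ p q q = p := by
    unfold swapZ
    split_ifs <;> omega
  -- The pair `(-p, q)` is the root orthogonal to `(p, q)`. The swap rewrites it as `(-q, p)`, the
  -- same root but outside the normal form `|a| < b`, so the bijection below must fix it by decree.
  -- All remaining pairs stay in normal form.
  have key : ∀ a b, ((a = p ∨ a = -p) ∧ b = q) ∨ ¬ ((a = p ∨ a = -p) ∧ b = q) ∧
      (a ≠ 0 → -b < a → a < b → b ≤ n → swapZ p q a ≠ 0 ∧ -swapZ p q b < swapZ p q a ∧
        swapZ p q a < swapZ p q b ∧ swapZ p q b ≤ n ∧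
        ¬ ((swapZ p q a = p ∨ swapZ p q a = -p) ∧ swapZ p q b = q)) := by
    obtain ⟨h1, h2, h3⟩ := h
    intro a b
    by_cases h0 : ((a = p ∨ a = -p) ∧ b = q)
    · exact .inl h0
    refine .inr ⟨h0, fun h4 h5 h6 h7 => ?_⟩
    unfold swapZ
    split_ifs <;> omega
  refine Finset.card_nbij'
    (fun x => if (x.1 = p ∨ x.1 = -p) ∧ x.2 = q then x else (swapZ p q x.1, swapZ p q x.2))
    (fun x => if (x.1 = p ∨ x.1 = -p) ∧ x.2 = q then x else (swapZ p q x.1, swapZ p q x.2))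
    ?_ ?_ ?_ ?_
  · rintro ⟨a, b⟩ hx
    simp only [Finset.coe_erase, Set.mem_sdiff, Finset.mem_coe, mem_rootInv,
      Set.mem_singleton_iff, Prod.mk.injEq] at hx ⊢
    rcases key a b with h0 | ⟨h0, h4⟩
    · rw [if_pos h0, mem_rootInv]
      obtain ⟨hb, rfl⟩ := h0
      obtain rfl : a = -p := by tauto
      rw [e1, e2, hf] at hx
      rw [hf]
      omega
    · rw [if_neg h0, mem_rootInv]
      have := h4 hx.1.2.1 hx.1.2.2.1 hx.1.2.2.2.1 hx.1.1
      exact ⟨this.2.2.2.1, this.1, this.2.1, this.2.2.1, hx.1.2.2.2.2⟩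
  · rintro ⟨a, b⟩ hx
    simp only [Finset.coe_erase, Set.mem_sdiff, Finset.mem_coe, mem_rootInv,
      Set.mem_singleton_iff] at hx ⊢
    rcases key a b with h0 | ⟨h0, h4⟩
    · rw [if_pos h0, mem_rootInv]
      obtain ⟨hb, rfl⟩ := h0
      rcases hb with rfl | rfl
      · omega
      · rw [e1, e2, hf]
        rw [hf] at hx
        simp only [Prod.mk.injEq]
        omega
    · rw [if_neg h0, mem_rootInv, swapZ_swapZ h, swapZ_swapZ h]
      have := h4 hx.2.1 hx.2.2.1 hx.2.2.2.1 hx.1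
      refine ⟨⟨this.2.2.2.1, this.1, this.2.1, this.2.2.1, hx.2.2.2.2⟩, fun h5 => ?_⟩
      rw [Prod.mk.injEq] at h5
      exact this.2.2.2.2 ⟨.inl h5.1, h5.2⟩
  · rintro ⟨a, b⟩ hx
    simp only [Finset.coe_erase, Set.mem_sdiff, Finset.mem_coe, mem_rootInv,
      Set.mem_singleton_iff, Prod.mk.injEq] at hx
    rcases key a b with h0 | ⟨h0, h4⟩
    · simp [h0]
    · have := h4 hx.1.2.1 hx.1.2.2.1 hx.1.2.2.2.1 hx.1.1
      simp only [if_neg h0]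
      rw [if_neg this.2.2.2.2]
      simp only [swapZ_swapZ h]
  · rintro ⟨a, b⟩ hx
    simp only [Finset.mem_coe, mem_rootInv] at hx
    rcases key a b with h0 | ⟨h0, h4⟩
    · simp [h0]
    · have := h4 hx.2.1 hx.2.2.1 hx.2.2.2.1 hx.1
      simp only [if_neg h0]
      rw [if_neg this.2.2.2.2]
      simp only [swapZ_swapZ h]

/-! ### Length and descents in `D_n`. -/

variable {n : ℕ}

theorem entry_coe (γ : Equiv.Perm (Idx n)) (k : Idx n) : entry γ k = γ k := by
  rw [entry, dif_pos k.2]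

theorem entry_of_notMem (γ : Equiv.Perm (Idx n)) {i : ℤ}
    (h : ¬ (i ≠ 0 ∧ -(n : ℤ) ≤ i ∧ i ≤ n)) : entry γ i = 0 := by
  rw [entry, dif_neg h]

theorem entry_mul (γ δ : Equiv.Perm (Idx n)) (i : ℤ) :
    entry (γ * δ) i = entry γ (entry δ i) := by
  by_cases h : i ≠ 0 ∧ -(n : ℤ) ≤ i ∧ i ≤ n
  · lift i to Idx n using h
    rw [entry_coe, entry_coe, entry_coe, Equiv.Perm.mul_apply]
  · rw [entry_of_notMem _ h, entry_of_notMem _ h, entry_of_notMem _ (by simp)]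

theorem isSigned_entry {γ : Equiv.Perm (Idx n)} (hγ : γ ∈ B n) : IsSigned n (entry γ) := by
  have hodd : ∀ i, γ (-i) = -γ i := hγ
  refine ⟨fun k => ?_, fun k h1 h2 => ?_, fun k h1 h2 => ?_, fun a b h1 h2 h3 h4 h => ?_⟩
  · by_cases h : k ≠ 0 ∧ -(n : ℤ) ≤ k ∧ k ≤ n
    · lift k to Idx n using h
      rw [← coe_neg_idx, entry_coe, hodd, entry_coe, coe_neg_idx]
    · rw [entry_of_notMem _ h, entry_of_notMem _ (by omega), neg_zero]
  · lift k to Idx n using ⟨by omega, by omega, h2⟩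
    rw [entry_coe]
    exact idx_ne_zero _
  · lift k to Idx n using ⟨by omega, by omega, h2⟩
    rw [entry_coe, abs_le]
    exact (γ k).2.2
  · lift a to Idx n using ⟨by omega, by omega, h2⟩
    lift b to Idx n using ⟨by omega, by omega, h4⟩
    rw [entry_coe, entry_coe, abs_eq_abs, ← coe_neg_idx, ← hodd] at h
    rcases h with h | h
    · rw [γ.injective (Subtype.ext h)]
    · have := congrArg Subtype.val (γ.injective (Subtype.ext h))
      rw [coe_neg_idx] at this
      omega

theorem coe_signedSwap {a b : Idx n} (h : (a : ℤ) ≠ -b) (k : Idx n) :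
    (signedSwap a b k : ℤ) = swapZ a b k := by
  have ha := idx_ne_zero a
  have hb := idx_ne_zero b
  rw [signedSwap, Equiv.Perm.mul_apply, Equiv.swap_apply_def, Equiv.swap_apply_def, swapZ]
  simp only [Subtype.ext_iff, apply_ite Subtype.val, coe_neg_idx]
  split_ifs <;> omega

/-- The smaller entry of the simple root of the `i`-th generator. -/
def rootLo (i : ℕ) : ℤ := if i = 0 then -1 else i

/-- The larger entry of the simple root of the `i`-th generator. -/
def rootHi (i : ℕ) : ℤ := if i = 0 then 2 else i + 1

theorem isSimple_root {i : ℕ} (hi : i < n) (h0 : i = 0 → 2 ≤ n) :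
    IsSimple n (rootLo i) (rootHi i) := by
  unfold IsSimple rootLo rootHi
  split_ifs <;> omega

theorem coe_gen {i : Fin n} (h0 : (i : ℕ) = 0 → 2 ≤ n) (k : Idx n) :
    (gen n i k : ℤ) = swapZ (rootLo i) (rootHi i) k := by
  unfold gen rootLo rootHi
  split_ifs with h h'
  · rw [coe_signedSwap (by simp)]
    unfold swapZ
    simp only
    split_ifs <;> omega
  · exact absurd (h0 h) h'
  · rw [coe_signedSwap (by simp; omega)]

theorem gen_eq_one {i : Fin n} (h0 : ¬ ((i : ℕ) = 0 → 2 ≤ n)) : gen n i = 1 := by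
  push Not at h0
  rw [gen, dif_pos h0.1, dif_neg (by omega)]

theorem gen_mem_B (i : Fin n) : gen n i ∈ B n := by
  by_cases h0 : (i : ℕ) = 0 → 2 ≤ n
  · intro k
    ext
    rw [coe_neg_idx, coe_gen h0, coe_gen h0, coe_neg_idx, swapZ_neg (isSimple_root i.2 h0)]
  · rw [gen_eq_one h0]
    exact one_mem _

theorem gen_mem_D (i : Fin n) : gen n i ∈ D n := by
  refine ⟨gen_mem_B i, ?_⟩
  by_cases h0 : (i : ℕ) = 0 → 2 ≤ n
  · have hN : N1 (gen n i) = ((Finset.Icc 1 (n : ℤ)).filter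
        fun k => swapZ (rootLo i) (rootHi i) k < 0).card := by
      refine Finset.card_bij (fun k _ => (k : ℤ)) ?_ (fun a _ b _ h => Subtype.ext h) ?_
      · intro k hk
        have := k.2
        simp only [Finset.mem_filter, mem_posIdx, coe_gen h0] at hk
        simp only [Finset.mem_filter, Finset.mem_Icc]
        exact ⟨by omega, hk.2⟩
      · intro k hk
        simp only [Finset.mem_filter, Finset.mem_Icc] at hk
        refine ⟨⟨k, by omega⟩, ?_, rfl⟩
        simp only [Finset.mem_filter, mem_posIdx, coe_gen h0]
        exact ⟨by omega, hk.2⟩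
    rw [hN]
    by_cases hi : (i : ℕ) = 0
    · have : ((Finset.Icc 1 (n : ℤ)).filter
          fun k => swapZ (rootLo i) (rootHi i) k < 0) = {1, 2} := by
        have := h0 hi
        ext k
        simp only [Finset.mem_filter, Finset.mem_Icc, Finset.mem_insert, Finset.mem_singleton,
          rootLo, rootHi, if_pos hi, swapZ]
        split_ifs <;> omega
      rw [this]
      decide
    · have : ((Finset.Icc 1 (n : ℤ)).filter
          fun k => swapZ (rootLo i) (rootHi i) k < 0) = ∅ := by
        refine Finset.filter_false_of_mem fun k hk => ?_
        simp only [Finset.mem_Icc, rootLo, rootHi, if_neg hi, swapZ] at hk ⊢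
        split_ifs <;> omega
      rw [this]
      simp
  · rw [gen_eq_one h0, N1_one]
    simp

theorem entry_mul_gen (γ : Equiv.Perm (Idx n)) {i : Fin n} (h0 : (i : ℕ) = 0 → 2 ≤ n) (k : ℤ) :
    entry (γ * gen n i) k = entry γ (swapZ (rootLo i) (rootHi i) k) := by
  by_cases h : k ≠ 0 ∧ -(n : ℤ) ≤ k ∧ k ≤ n
  · lift k to Idx n using h
    rw [entry_mul, entry_coe, coe_gen h0]
  · have hs := isSimple_root i.2 h0
    unfold IsSimple at hs
    have : swapZ (rootLo i) (rootHi i) k = k := by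
      unfold swapZ
      split_ifs <;> omega
    rw [this, entry_of_notMem _ h, entry_of_notMem _ h]

theorem gen_mul_gen (i : Fin n) : gen n i * gen n i = 1 := by
  by_cases h0 : (i : ℕ) = 0 → 2 ≤ n
  · ext k
    rw [Equiv.Perm.mul_apply, coe_gen h0, coe_gen h0, swapZ_swapZ (isSimple_root i.2 h0)]
    rfl
  · rw [gen_eq_one h0, one_mul]

theorem card_rootInv_mul_gen_of_lt {γ : Equiv.Perm (Idx n)} (hγ : γ ∈ B n) {i : Fin n}
    (h0 : (i : ℕ) = 0 → 2 ≤ n) (h : entry γ (rootLo i) < entry γ (rootHi i)) :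
    (rootInv n (entry (γ * gen n i))).card = (rootInv n (entry γ)).card + 1 := by
  rw [funext (entry_mul_gen γ h0)]
  exact card_rootInv_swap (isSimple_root i.2 h0) (isSigned_entry hγ).odd h

theorem card_rootInv_mul_gen_of_gt {γ : Equiv.Perm (Idx n)} (hγ : γ ∈ B n) {i : Fin n}
    (h0 : (i : ℕ) = 0 → 2 ≤ n) (h : entry γ (rootHi i) < entry γ (rootLo i)) :
    (rootInv n (entry γ)).card = (rootInv n (entry (γ * gen n i))).card + 1 := by
  have hs := isSimple_root i.2 h0
  have e1 : swapZ (rootLo i) (rootHi i) (rootLo i) = rootHi i := by simp [swapZ]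
  have e2 : swapZ (rootLo i) (rootHi i) (rootHi i) = rootLo i := by
    unfold swapZ
    split_ifs <;> omega
  have := card_rootInv_mul_gen_of_lt (mul_mem hγ (gen_mem_B i)) h0
    (by rwa [entry_mul_gen _ h0, entry_mul_gen _ h0, e1, e2])
  rwa [mul_assoc, gen_mul_gen, mul_one] at this

theorem entry_root_ne {γ : Equiv.Perm (Idx n)} {i : Fin n} (h0 : (i : ℕ) = 0 → 2 ≤ n) :
    entry γ (rootLo i) ≠ entry γ (rootHi i) := by
  obtain ⟨h1, h2, h3⟩ := isSimple_root i.2 h0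
  intro h
  rw [entry, entry, dif_pos (by omega), dif_pos (by omega)] at h
  have := congrArg Subtype.val (γ.injective (Subtype.ext h))
  simp only at this
  omega

theorem rootInv_one : rootInv n (entry (1 : Equiv.Perm (Idx n))) = ∅ := by
  rw [Finset.eq_empty_iff_forall_notMem]
  rintro ⟨a, b⟩ h
  rw [mem_rootInv] at h
  rw [entry, entry, dif_pos (by omega), dif_pos (by omega)] at h
  simp only [Equiv.Perm.one_apply] at h
  omega

theorem gen_prod_mem (w : List (Fin n)) : (w.map (gen n)).prod ∈ B n := by
  apply Subgroup.list_prod_mem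
  intro x hx
  obtain ⟨i, -, rfl⟩ := List.mem_map.1 hx
  exact gen_mem_B i

theorem card_rootInv_prod_le (w : List (Fin n)) :
    (rootInv n (entry (w.map (gen n)).prod)).card ≤ w.length := by
  induction w using List.reverseRecOn with
  | nil => simp [rootInv_one]
  | append_singleton w i ih =>
    have hw := gen_prod_mem w
    rw [List.map_append, List.prod_append, List.map_singleton, List.prod_singleton,
      List.length_append, List.length_singleton]
    by_cases h0 : (i : ℕ) = 0 → 2 ≤ n
    · rcases lt_or_gt_of_ne (entry_root_ne (γ := (w.map (gen n)).prod) h0) with h | h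
      · rw [card_rootInv_mul_gen_of_lt hw h0 h]
        omega
      · have := card_rootInv_mul_gen_of_gt hw h0 h
        omega
    · rw [gen_eq_one h0, mul_one]
      omega

/-- An element of `D_n` without descents is the identity. -/
theorem eq_one_of_forall_lt {γ : Equiv.Perm (Idx n)} (hγ : γ ∈ D n)
    (h : ∀ i : Fin n, ((i : ℕ) = 0 → 2 ≤ n) → entry γ (rootLo i) < entry γ (rootHi i)) :
    γ = 1 := by
  have hs := isSigned_entry hγ.1
  have hstep : ∀ i : ℕ, 1 ≤ i → i + 1 ≤ n → entry γ i < entry γ (i + 1) := by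
    intro i h1 h2
    have := h ⟨i, by omega⟩ (by simp only; omega)
    simpa only [rootLo, rootHi, if_neg (show i ≠ 0 by omega)] using this
  -- The generators `s_1` and `s_0` give `γ(1) < γ(2)` and `-γ(1) < γ(2)`, which forces `γ(2) > 0`.
  have hmono : ∀ i : ℕ, 2 ≤ i → i ≤ n → 0 < entry γ i := by
    intro i hi
    induction i, hi using Nat.le_induction with
    | base =>
      intro hn
      have h1 := hstep 1 le_rfl hn
      have h2 := h ⟨0, by omega⟩ (fun _ => hn)
      simp only [rootLo, rootHi, if_true, hs.odd] at h2
      norm_num at h1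
      push_cast
      omega
    | succ i hi ih =>
      intro hn
      have h1 := hstep i (by omega) hn
      have h2 := ih (by omega)
      push_cast
      omega
  -- Only `γ(1)` could still be negative, and then `N1 γ = 1` would be odd.
  have hpos : ∀ i : ℕ, 1 ≤ i → i ≤ n → 0 < entry γ i := by
    intro i h1 h2
    by_cases hi : 2 ≤ i
    · exact hmono i hi h2
    obtain rfl : i = 1 := by omega
    by_contra hneg
    have hne := hs.ne_zero 1 le_rfl (by omega)
    have hN : N1 γ = 1 := by
      rw [N1, Finset.card_eq_one]
      refine ⟨⟨1, by omega⟩, ?_⟩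
      ext k
      simp only [Finset.mem_filter, mem_posIdx, Finset.mem_singleton, ← entry_coe,
        Subtype.ext_iff]
      constructor
      · rintro ⟨h3, h4⟩
        by_contra hk
        have hkn := k.2
        have := hmono (k : ℤ).toNat (by omega) (by omega)
        rw [Int.toNat_of_nonneg (by omega)] at this
        omega
      · intro hk
        rw [hk]
        norm_num at hneg
        omega
    have := hγ.2
    rw [hN] at this
    exact absurd this (by decide)
  -- An increasing sequence of `n` integers between `1` and `n` is squeezed to the identity, from
  -- below here and from above in `hle`.
  have hge : ∀ i : ℕ, 1 ≤ i → i ≤ n → (i : ℤ) ≤ entry γ i := by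
    intro i hi
    induction i, hi using Nat.le_induction with
    | base => intro hn; have := hpos 1 le_rfl hn; push_cast at this ⊢; omega
    | succ i hi ih =>
      intro hn
      have h1 := hstep i (by omega) hn
      have h2 := ih (by omega)
      push_cast
      omega
  have hle : ∀ j : ℕ, j + 1 ≤ n → entry γ ((n - j : ℕ) : ℤ) ≤ ((n - j : ℕ) : ℤ) := by
    intro j
    induction j with
    | zero =>
      intro hn
      exact (le_abs_self _).trans (hs.abs_le _ (by omega) (by omega))
    | succ j ih =>
      intro hn
      have h1 := hstep (n - (j + 1)) (by omega) (by omega)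
      have h2 := ih (by omega)
      have e : ((n - j : ℕ) : ℤ) = ((n - (j + 1) : ℕ) : ℤ) + 1 := by omega
      rw [e] at h2
      omega
  have heq : ∀ i : ℕ, 1 ≤ i → i ≤ n → entry γ i = i := by
    intro i h1 h2
    have h3 := hle (n - i) (by omega)
    rw [show n - (n - i) = i by omega] at h3
    exact le_antisymm h3 (hge i h1 h2)
  ext k
  rw [Equiv.Perm.one_apply, ← entry_coe]
  have hk := k.2
  by_cases hk0 : 0 < (k : ℤ)
  · have := heq (k : ℤ).toNat (by omega) (by omega)
    rwa [Int.toNat_of_nonneg (by omega)] at this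
  · have := heq (-(k : ℤ)).toNat (by omega) (by omega)
    rw [Int.toNat_of_nonneg (by omega), hs.odd] at this
    omega

/-- Sorting: as long as some simple root is inverted, multiplying by its generator removes one
inverted root. -/
theorem exists_prod_gen_eq {γ : Equiv.Perm (Idx n)} (hγ : γ ∈ D n) :
    ∃ w : List (Fin n), w.length = (rootInv n (entry γ)).card ∧ (w.map (gen n)).prod = γ := by
  induction hm : (rootInv n (entry γ)).card generalizing γ with
  | zero =>
    refine ⟨[], rfl, ?_⟩
    rw [List.map_nil, List.prod_nil, eq_one_of_forall_lt hγ]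
    intro i h0
    rcases lt_or_gt_of_ne (entry_root_ne (γ := γ) h0) with h | h
    · exact h
    · have := card_rootInv_mul_gen_of_gt hγ.1 h0 h
      omega
  | succ m ih =>
    by_cases hex : ∃ i : Fin n, ((i : ℕ) = 0 → 2 ≤ n) ∧ entry γ (rootHi i) < entry γ (rootLo i)
    · obtain ⟨i, h0, h⟩ := hex
      have := card_rootInv_mul_gen_of_gt hγ.1 h0 h
      obtain ⟨w, h1, h2⟩ := ih (mul_mem hγ (gen_mem_D i)) (by omega)
      refine ⟨w ++ [i], by simp [h1], ?_⟩
      rw [List.map_append, List.prod_append, h2, List.map_singleton, List.prod_singleton,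
        mul_assoc, gen_mul_gen, mul_one]
    · push Not at hex
      have : γ = 1 := eq_one_of_forall_lt hγ fun i h0 =>
        lt_of_le_of_ne (hex i h0) (entry_root_ne h0)
      rw [this, rootInv_one] at hm
      simp at hm

theorem lengthD_eq_card_rootInv {γ : Equiv.Perm (Idx n)} (hγ : γ ∈ D n) :
    lengthD γ = (rootInv n (entry γ)).card := by
  apply le_antisymm
  · exact Nat.sInf_le (exists_prod_gen_eq hγ)
  · refine le_csInf ⟨_, exists_prod_gen_eq hγ⟩ ?_
    rintro k ⟨w, rfl, rfl⟩
    exact card_rootInv_prod_le w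

theorem lengthD_eq {γ : Equiv.Perm (Idx n)} (hγ : γ ∈ D n) :
    lengthD γ = invList (word (entry γ) n) + negSum (word (entry γ) n) := by
  rw [lengthD_eq_card_rootInv hγ, (isSigned_entry hγ.1).card_rootInv]

/-- The guard on `i = 0` covers `n = 1`, where `s_0` is the identity and gives no descent. -/
theorem mem_DesD {γ : Equiv.Perm (Idx n)} (hγ : γ ∈ D n) {i : ℕ} :
    i ∈ DesD γ ↔ i < n ∧ (i = 0 → 2 ≤ n) ∧ entry γ (rootHi i) < entry γ (rootLo i) := by
  have key : ∀ j : Fin n, lengthD (γ * gen n j) < lengthD γ ↔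
      ((j : ℕ) = 0 → 2 ≤ n) ∧ entry γ (rootHi j) < entry γ (rootLo j) := by
    intro j
    rw [lengthD_eq_card_rootInv hγ, lengthD_eq_card_rootInv (mul_mem hγ (gen_mem_D j))]
    by_cases h0 : (j : ℕ) = 0 → 2 ≤ n
    · rcases lt_or_gt_of_ne (entry_root_ne (γ := γ) h0) with h | h
      · have := card_rootInv_mul_gen_of_lt hγ.1 h0 h
        simp only [h.not_gt, and_false, iff_false]
        omega
      · have := card_rootInv_mul_gen_of_gt hγ.1 h0 h
        simp only [h, and_true]
        exact ⟨fun _ => h0, fun _ => by omega⟩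
    · simp [gen_eq_one h0, h0]
  simp only [DesD, Finset.mem_map, Finset.mem_filter, Finset.mem_univ, true_and, key]
  constructor
  · rintro ⟨j, h, rfl⟩
    exact ⟨j.2, h⟩
  · rintro ⟨h1, h2⟩
    exact ⟨⟨i, h1⟩, h2, rfl⟩

/-! ### The formula for `dmaj`, and group elements recovered from windows. -/

theorem dmaj_eq (γ : Equiv.Perm (Idx n)) :
    dmaj γ = majList (word (entry γ) n) + negSum (word (entry γ) n) := by
  have hfilter : ∀ s : Multiset ℕ, (s.filter (· ≠ 0)).sum = s.sum := by
    intro s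
    induction s using Multiset.induction with
    | empty => rfl
    | cons a s ih =>
      by_cases h : a = 0
      · simpa [h] using ih
      · simpa [h] using ih
  rw [dmaj, DDes, Multiset.sum_add, hfilter, majList_word]
  congr 1
  · rw [Des, Finset.sum_val]
    rfl
  · rw [negSum, sum_map_word]
    change ∑ i ∈ (Finset.Icc 1 n).filter fun i : ℕ => entry γ i < 0, (-entry γ i - 1).toNat = _
    -- Truncation by `toNat` makes nonnegative entries contribute `0`, so the sign condition can be
    -- dropped.
    rw [Finset.sum_filter_of_ne]
    · refine Finset.sum_nbij' (fun i : ℕ => (i : ℤ)) Int.toNat ?_ ?_ ?_ ?_ ?_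
      all_goals simp only [Finset.mem_Icc]
      all_goals intros
      all_goals first | trivial | omega
    · intro x _ hx
      omega

theorem exists_entry_eq {f : ℤ → ℤ} (h0 : ∀ k, 1 ≤ k → k ≤ (n : ℤ) → f k ≠ 0 ∧ |f k| ≤ n)
    (hinj : ∀ a b, 1 ≤ a → a ≤ (n : ℤ) → 1 ≤ b → b ≤ (n : ℤ) → |f a| = |f b| → a = b) :
    ∃ δ ∈ B n, ∀ i, 1 ≤ i → i ≤ (n : ℤ) → entry δ i = f i := by
  have hg : ∀ k : Idx n, ∃ m : Idx n, (m : ℤ) = if 0 < (k : ℤ) then f k else -f (-k) := by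
    intro k
    have hk := k.2
    split_ifs with h
    · have := h0 k (by omega) (by omega)
      rw [abs_le] at this
      exact ⟨⟨f k, this⟩, rfl⟩
    · have := h0 (-k) (by omega) (by omega)
      rw [abs_le] at this
      exact ⟨⟨-f (-k), by omega⟩, rfl⟩
  choose g hg using hg
  have hodd : ∀ k, g (-k) = -g k := by
    intro k
    have hk := k.2
    ext
    rw [coe_neg_idx, hg, hg, coe_neg_idx, neg_neg]
    split_ifs <;> omega
  have hginj : Function.Injective g := by
    intro a b hab
    have ha := a.2
    have hb := b.2
    have habs : ∀ k : Idx n, |(g k : ℤ)| = |f (if 0 < (k : ℤ) then k else -k)| := by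
      intro k
      rw [hg]
      split_ifs
      · rfl
      · rw [abs_neg]
    have h1 := hinj (if 0 < (a : ℤ) then a else -a) (if 0 < (b : ℤ) then b else -b)
      (by split_ifs <;> omega) (by split_ifs <;> omega) (by split_ifs <;> omega)
      (by split_ifs <;> omega) (by rw [← habs, ← habs, hab])
    have h2 : (a : ℤ) = b ∨ (a : ℤ) = -b := by
      split_ifs at h1 <;> omega
    rcases h2 with h2 | h2
    · exact Subtype.ext h2
    · have h3 : a = -b := Subtype.ext h2
      rw [h3, hodd] at hab
      have h4 := congrArg Subtype.val hab
      have := idx_ne_zero (g b)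
      rw [coe_neg_idx] at h4
      omega
  refine ⟨Equiv.ofBijective g (Finite.injective_iff_bijective.1 hginj), hodd, fun i h1 h2 => ?_⟩
  lift i to Idx n using ⟨by omega, by omega, h2⟩
  rw [entry_coe, Equiv.ofBijective_apply, hg, if_pos (by omega)]

theorem N1_eq_countP (γ : Equiv.Perm (Idx n)) :
    N1 γ = (word (entry γ) n).countP (fun x => x < 0) := by
  rw [countP_word]
  refine Finset.card_bij (fun k _ => (k : ℤ)) ?_ (fun a _ b _ h => Subtype.ext h) ?_
  · intro k hk
    have := k.2
    simp only [Finset.mem_filter, mem_posIdx, Finset.mem_Icc, entry_coe] at hk ⊢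
    exact ⟨by omega, hk.2⟩
  · intro k hk
    simp only [Finset.mem_filter, Finset.mem_Icc] at hk
    lift k to Idx n using ⟨by omega, by omega, hk.1.2⟩
    rw [entry_coe] at hk
    exact ⟨k, by simp only [Finset.mem_filter, mem_posIdx]; omega, rfl⟩

theorem map_word (g f : ℤ → ℤ) (n : ℕ) : (word f n).map g = word (fun k => g (f k)) n := by
  induction n with
  | zero => rfl
  | succ n ih => rw [word, List.map_cons, ih, word]

theorem IsSigned.nodup_abs {f : ℤ → ℤ} (hf : IsSigned n f) :
    ((word f n).map abs).Nodup := by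
  rw [map_word, nodup_word]
  intro i j h1 h2 h3 h4
  have := hf.abs_inj i j (by omega) h3 h1 (by omega) h4
  omega

/-- Rearranging a window changes neither the absolute values nor the number of negative letters, so
it stays inside `D_n`. -/
theorem exists_word_entry_eq_of_perm {γ : Equiv.Perm (Idx n)} (hγ : γ ∈ D n) {l : List ℤ}
    (hl : l.Perm (word (entry γ) n)) : ∃ δ ∈ D n, word (entry δ) n = l := by
  have hs := isSigned_entry hγ.1
  obtain ⟨f, hf⟩ := exists_word_eq (hl.length_eq.trans (length_word _ _))
  have hnodup : (word (fun k => |f k|) n).Nodup := by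
    rw [← map_word, hf]
    exact (hl.map abs).nodup_iff.2 hs.nodup_abs
  rw [nodup_word] at hnodup
  obtain ⟨δ, hδ, h⟩ := exists_entry_eq (n := n) (f := f)
    (by
      intro k h1 h2
      have : f k ∈ word (entry γ) n := hl.subset (hf ▸ mem_word.2 ⟨k, h1, h2, rfl⟩)
      obtain ⟨i, h3, h4, h5⟩ := mem_word.1 this
      rw [← h5]
      exact ⟨hs.ne_zero i h3 h4, hs.abs_le i h3 h4⟩)
    (by
      intro a b h1 h2 h3 h4 h5
      rcases lt_trichotomy a b with h6 | h6 | h6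
      · exact absurd h5.symm (hnodup b a h1 h6 h4)
      · exact h6
      · exact absurd h5 (hnodup a b h3 h6 h2))
  have hw : word (entry δ) n = l := by rw [word_congr h, hf]
  refine ⟨δ, ⟨hδ, ?_⟩, hw⟩
  rw [N1_eq_countP, hw, hl.countP_eq, ← N1_eq_countP]
  exact hγ.2

/-! ### Letters of the window and values of the inverse. -/

theorem entry_inv_eq_iff (γ : Equiv.Perm (Idx n)) (a i : Idx n) :
    entry γ i = a ↔ entry γ⁻¹ a = i := by
  rw [entry_coe, entry_coe, ← Subtype.ext_iff, ← Subtype.ext_iff, Equiv.Perm.inv_eq_iff_eq,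
    eq_comm]

theorem mem_word_entry (γ : Equiv.Perm (Idx n)) (a : Idx n) :
    (a : ℤ) ∈ word (entry γ) n ↔ 0 < entry γ⁻¹ a := by
  rw [mem_word]
  constructor
  · rintro ⟨i, h1, h2, h3⟩
    lift i to Idx n using ⟨by omega, by omega, h2⟩
    rw [entry_inv_eq_iff] at h3
    omega
  · intro h
    rw [entry_coe] at h
    exact ⟨γ⁻¹ a, by omega, (γ⁻¹ a).2.2.2, by rw [entry_inv_eq_iff, entry_coe]⟩

theorem pair_sublist_word_entry (γ : Equiv.Perm (Idx n)) (a b : Idx n) :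
    [(a : ℤ), (b : ℤ)].Sublist (word (entry γ) n) ↔
      0 < entry γ⁻¹ b ∧ entry γ⁻¹ b < entry γ⁻¹ a := by
  rw [pair_sublist_word]
  constructor
  · rintro ⟨i, j, h1, h2, h3, h4, h5⟩
    lift i to Idx n using ⟨by omega, by omega, h3⟩
    lift j to Idx n using ⟨by omega, by omega, by omega⟩
    rw [entry_inv_eq_iff] at h4 h5
    omega
  · rintro ⟨h1, h2⟩
    rw [entry_coe, entry_coe] at h2
    rw [entry_coe] at h1
    exact ⟨γ⁻¹ a, γ⁻¹ b, by omega, by omega, (γ⁻¹ a).2.2.2, by rw [entry_inv_eq_iff, entry_coe],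
      by rw [entry_inv_eq_iff, entry_coe]⟩

/-! ### Foata's transformation on `D_n`. -/

section Foata

variable {γ δ : Equiv.Perm (Idx n)}

theorem nodup_word_entry (hγ : γ ∈ D n) : (word (entry γ) n).Nodup :=
  (isSigned_entry hγ.1).nodup_abs.of_map _

theorem entry_inv_pos_iff (hw : word (entry δ) n = foata (word (entry γ) n)) (a : Idx n) :
    0 < entry δ⁻¹ a ↔ 0 < entry γ⁻¹ a := by
  rw [← mem_word_entry, ← mem_word_entry, hw]
  exact (foata_perm _).mem_iff

/-- The only integers strictly between `a` and `b` are `0` and possibly `-a` or `-b`. None is a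
letter, since `a` and `b` are letters and a window never contains both a letter and its negative.
The case `(-2, 1)` is the negation of `(-1, 2)`. -/
theorem entry_inv_lt_iff_of_pos (hγ : γ ∈ D n)
    (hw : word (entry δ) n = foata (word (entry γ) n)) {a b : Idx n}
    (hab : (b : ℤ) = a + 1 ∨ (a : ℤ) = -1 ∧ (b : ℤ) = 2 ∨ (a : ℤ) = -2 ∧ (b : ℤ) = 1)
    (ha : 0 < entry γ⁻¹ a) (hb : 0 < entry γ⁻¹ b) :
    entry δ⁻¹ b < entry δ⁻¹ a ↔ entry γ⁻¹ b < entry γ⁻¹ a := by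
  have key : [(a : ℤ), (b : ℤ)].Sublist (foata (word (entry γ) n)) ↔
      [(a : ℤ), (b : ℤ)].Sublist (word (entry γ) n) := by
    refine pair_sublist_foata (nodup_word_entry hγ) fun z hz h1 h2 => ?_
    have hs := isSigned_entry hγ.1
    have hodd := (isSigned_entry (inv_mem hγ.1)).odd
    have hz0 : z ≠ 0 := by
      obtain ⟨i, h3, h4, rfl⟩ := mem_word.1 hz
      exact hs.ne_zero i h3 h4
    have hza : z ≠ -a := by
      rintro rfl
      rw [← coe_neg_idx, mem_word_entry, coe_neg_idx, hodd] at hz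
      omega
    have hzb : z ≠ -b := by
      rintro rfl
      rw [← coe_neg_idx, mem_word_entry, coe_neg_idx, hodd] at hz
      omega
    omega
  rw [← hw, pair_sublist_word_entry, pair_sublist_word_entry, entry_inv_pos_iff hw] at key
  simpa only [hb, true_and] using key

/-- When the inverse takes values of opposite sign at `p` and `q`, the preserved signs decide the
comparison. When both are negative, oddness replaces `(p, q)` by `(-q, -p)`, whose values are
positive. -/
theorem entry_inv_lt_iff (hγ : γ ∈ D n) (hδ : δ ∈ D n)
    (hw : word (entry δ) n = foata (word (entry γ) n)) {p q : ℤ} (h : IsSimple n p q) :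
    entry δ⁻¹ q < entry δ⁻¹ p ↔ entry γ⁻¹ q < entry γ⁻¹ p := by
  obtain ⟨h1, h2, h3⟩ := h
  lift p to Idx n using by omega
  lift q to Idx n using by omega
  have oddγ := (isSigned_entry (inv_mem hγ.1)).odd
  have oddδ := (isSigned_entry (inv_mem hδ.1)).odd
  have hp := entry_inv_pos_iff hw p
  have hq := entry_inv_pos_iff hw q
  have hp' : entry γ⁻¹ p ≠ 0 := by rw [entry_coe]; exact idx_ne_zero _
  have hq' : entry γ⁻¹ q ≠ 0 := by rw [entry_coe]; exact idx_ne_zero _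
  have hp'' : entry δ⁻¹ p ≠ 0 := by rw [entry_coe]; exact idx_ne_zero _
  have hq'' : entry δ⁻¹ q ≠ 0 := by rw [entry_coe]; exact idx_ne_zero _
  by_cases hpp : 0 < entry γ⁻¹ p
  · by_cases hqq : 0 < entry γ⁻¹ q
    · exact entry_inv_lt_iff_of_pos hγ hw (by omega) hpp hqq
    · omega
  · by_cases hqq : 0 < entry γ⁻¹ q
    · omega
    · have := entry_inv_lt_iff_of_pos hγ hw (a := -q) (b := -p)
        (by simp only [coe_neg_idx]; omega) (by rw [coe_neg_idx, oddγ]; omega)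
        (by rw [coe_neg_idx, oddγ]; omega)
      simp only [coe_neg_idx, oddγ, oddδ] at this
      omega

theorem DesD_inv_eq (hγ : γ ∈ D n) (hδ : δ ∈ D n)
    (hw : word (entry δ) n = foata (word (entry γ) n)) : DesD δ⁻¹ = DesD γ⁻¹ := by
  ext i
  rw [mem_DesD (inv_mem hδ), mem_DesD (inv_mem hγ)]
  refine and_congr_right fun hi => and_congr_right fun h0 => ?_
  exact entry_inv_lt_iff hγ hδ hw (isSimple_root hi h0)

theorem lengthD_eq_dmaj (hγ : γ ∈ D n) (hδ : δ ∈ D n)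
    (hw : word (entry δ) n = foata (word (entry γ) n)) : lengthD δ = dmaj γ := by
  rw [lengthD_eq hδ, dmaj_eq, hw, invList_foata (nodup_word_entry hγ), negSum, negSum,
    ((foata_perm _).map _).sum_eq]

end Foata

theorem eq_of_word_entry_eq {γ γ' : Equiv.Perm (Idx n)} (hγ : γ ∈ D n) (hγ' : γ' ∈ D n)
    (h : word (entry γ) n = word (entry γ') n) : γ = γ' := by
  ext k
  rw [← entry_coe, ← entry_coe]
  have hk := k.2
  by_cases h0 : 0 < (k : ℤ)
  · exact eq_of_word_eq h (by omega) (by omega)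
  · have := eq_of_word_eq h (i := -k) (by omega) (by omega)
    rwa [(isSigned_entry hγ.1).odd, (isSigned_entry hγ'.1).odd, neg_inj] at this

/-- Foata's transformation acting on windows is a bijection of `D_n` that carries `dmaj` to the
length and preserves the descent set of the inverse. -/
theorem exists_equiv (n : ℕ) : ∃ e : D n ≃ D n, ∀ γ : D n,
    lengthD (e γ : Equiv.Perm (Idx n)) = dmaj (γ : Equiv.Perm (Idx n)) ∧
      DesD (((e γ)⁻¹ : D n) : Equiv.Perm (Idx n)) =
        DesD ((γ⁻¹ : D n) : Equiv.Perm (Idx n)) := by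
  have hex : ∀ γ : D n, ∃ δ : D n, word (entry δ.1) n = foata (word (entry γ.1) n) := by
    intro γ
    obtain ⟨δ, hδ, h⟩ := exists_word_entry_eq_of_perm γ.2 (foata_perm _)
    exact ⟨⟨δ, hδ⟩, h⟩
  choose φ hφ using hex
  have hinj : Function.Injective φ := by
    intro γ γ' h
    have h1 := hφ γ
    rw [h, hφ γ'] at h1
    exact Subtype.ext (eq_of_word_entry_eq γ.2 γ'.2 (foata_injective h1.symm))
  refine ⟨Equiv.ofBijective φ (Finite.injective_iff_bijective.1 hinj), fun γ => ?_⟩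
  exact ⟨lengthD_eq_dmaj γ.2 (φ γ).2 (hφ γ), DesD_inv_eq γ.2 (φ γ).2 (hφ γ)⟩

end TypeD

theorem mainTheorem2 (n : ℕ) (M : Finset ℕ) (hM : M ⊆ Finset.range n) :
    ∑ γ : TypeD.D n with TypeD.DesD ((γ⁻¹ : TypeD.D n) : Equiv.Perm (TypeD.Idx n)) = M,
        (Polynomial.X : ℤ[X]) ^ TypeD.dmaj (γ : Equiv.Perm (TypeD.Idx n)) =
      ∑ γ : TypeD.D n with TypeD.DesD ((γ⁻¹ : TypeD.D n) : Equiv.Perm (TypeD.Idx n)) = M,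
        (Polynomial.X : ℤ[X]) ^ TypeD.lengthD (γ : Equiv.Perm (TypeD.Idx n)) := by
  obtain ⟨e, he⟩ := TypeD.exists_equiv n
  refine Finset.sum_equiv e (fun γ => ?_) (fun γ _ => ?_)
  · simp only [Finset.mem_filter, Finset.mem_univ, true_and, (he γ).2]
  · rw [(he γ).1]
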